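/- Let $F$ be a finite field with $q$ elements, and let $T_3(q)$ be the ring of lower triangular $3\times 3$ matrices over $F$. Let ${}^2T_3(q)=T_3(q)\times T_3(q)$, regarded as a left $T_3(q)$-module. The cyclic submodule generated by a pair $(X,Y)$ is $T_3(q)(X,Y)=\{(AX,AY): A\in T_3(q)\}$. A cyclic submodule is *free* if it has a generator $(X,Y)$ such that $(AX,AY)=(0,0)$ implies $A=0$, and *non-free* otherwise. A pair $(X,Y)$ is *unimodular* if $x_{ii}\ne 0$ or $y_{ii}\neq 0$ for each $i=1,2,3$. A free cyclic submodule is *non-unimodular* if it is not generated by any unimodular pair. An *outlier* is a pair that lies in no cyclic submodule generated by a unimodular pair. For $a,b,c,d,e\in F$ write $L(a,b;c,d,e)=\begin{pmatrix}0&0&0\\ a&b&0\\ c&d&e\end{pmatrix}$. **Proposition.** There are exactly $(q+1)^2q^5$ non-free cyclic submodules of ${}^2T_3(q)$ that are not contained in any non-unimodular free cyclic submodule of ${}^2T_3(q)$. They are exactly the members of the following subsets, which are organized into $q+1$ sets of $q^2+q$ subsets each; all these subsets are pairwise disjoint, and each of them has exactly $q^4$ members. The first set consists of the $q^2$ subsets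 $$\{T_3(q)\big(L(p_{21},1;p_{31},0,1),\,L(r_{21},0;r_{31},r_{32},r_{33})\big):\ p_{21},p_{31},r_{21},r_{31}\in F\},\qquad r_{32},r_{33}\in F,$$ and the $q$ subsets $$\{T_3(q)\big(L(p_{21},1;p_{31},0,0),\,L(r_{21},0;r_{31},r_{32},1)\big):\ p_{21},p_{31},r_{21},r_{31}\in F\},\qquad r_{32}\in F.$$ For each $k\in F$, the $k$-set consists of the $q^2$ subsets $$\{T_3(q)\big(L(p_{21},k;p_{31},p_{32},p_{33}),\,L(r_{21},1;r_{31},0,1)\big):\ p_{21},p_{31},r_{21},r_{31}\in F\},\qquad p_{32},p_{33}\in F,$$ and the $q$ subsets $$\{T_3(q)\big(L(p_{21},k;p_{31},p_{32},1),\,L(r_{21},1;r_{31},0,0)\big):\ p_{21},p_{31},r_{21},r_{31}\in F\},\qquad p_{32}\in F.$$ The first set and the $k$-sets $(k\in F)$ are $q+1$ distinct sets, no two of which have a subset in common. Moreover, every other non-free cyclic submodule of ${}^2T_3(q)$ is contained in a free cyclic submodule generated by an outlier. -/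

import Mathlib

namespace TriPairs

/-- The ring `T_n(F)` of lower triangular `n × n` matrices over `F`. -/
def LowerTri (n : ℕ) (F : Type*) [Field F] : Subring (Matrix (Fin n) (Fin n) F) where
  carrier := {M | ∀ i j : Fin n, i < j → M i j = 0}
  zero_mem' := fun _ _ _ => rfl
  one_mem' := fun _ _ h => Matrix.one_apply_ne h.ne
  add_mem' := fun {A B} hA hB i j h => by
    rw [Matrix.add_apply, hA i j h, hB i j h, add_zero]
  neg_mem' := fun {A} hA i j h => by
    rw [Matrix.neg_apply, hA i j h, neg_zero]
  mul_mem' := fun {A B} hA hB i j h => by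
    rw [Matrix.mul_apply]
    refine Finset.sum_eq_zero fun l _ => ?_
    rcases lt_or_ge i l with hl | hl
    · rw [hA i l hl, zero_mul]
    · rw [hB l j (lt_of_le_of_lt hl h), mul_zero]

section general

variable {n : ℕ} {F : Type*} [Field F]

/-- The left cyclic submodule `T_n(F) (X, Y)` of the free left module of pairs. -/
def cyc (v : LowerTri n F × LowerTri n F) :
    Submodule (LowerTri n F) (LowerTri n F × LowerTri n F) :=
  Submodule.span (LowerTri n F) {v}

/-- The pair `(X, Y)` generates a free cyclic submodule: `(AX, AY) = (0, 0)` implies `A = 0`. -/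
def FreePair (v : LowerTri n F × LowerTri n F) : Prop :=
  ∀ A : LowerTri n F, (A * v.1, A * v.2) = ((0, 0) : LowerTri n F × LowerTri n F) → A = 0

/-- Free cyclic submodules. -/
def IsFreeCyclic (M : Submodule (LowerTri n F) (LowerTri n F × LowerTri n F)) : Prop :=
  ∃ v, M = cyc v ∧ FreePair v

/-- Non-free cyclic submodules. -/
def IsNonFreeCyclic (M : Submodule (LowerTri n F) (LowerTri n F × LowerTri n F)) : Prop :=
  (∃ v, M = cyc v) ∧ ¬ IsFreeCyclic M

/-- Unimodular pairs: at each diagonal position, one of the two entries is non-zero. -/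
def Unimodular (v : LowerTri n F × LowerTri n F) : Prop :=
  ∀ i : Fin n, v.1.1 i i ≠ 0 ∨ v.2.1 i i ≠ 0

/-- The projective line over `T_n(F)`: the cyclic submodules generated by unimodular pairs. -/
def projLine (n : ℕ) (F : Type*) [Field F] :
    Set (Submodule (LowerTri n F) (LowerTri n F × LowerTri n F)) :=
  {M | ∃ v, Unimodular v ∧ M = cyc v}

/-- Outliers: pairs contained in no point of the projective line. -/
def Outlier (v : LowerTri n F × LowerTri n F) : Prop :=
  ∀ M ∈ projLine n F, v ∉ M

/-- Non-unimodular free cyclic submodules: the free cyclic submodules that are not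
points of the projective line. -/
def IsNonUnimodularFreeCyclic
    (M : Submodule (LowerTri n F) (LowerTri n F × LowerTri n F)) : Prop :=
  IsFreeCyclic M ∧ M ∉ projLine n F

/-- The non-free cyclic submodules contained in no non-unimodular free cyclic submodule. -/
def exceptional (n : ℕ) (F : Type*) [Field F] :
    Set (Submodule (LowerTri n F) (LowerTri n F × LowerTri n F)) :=
  {M | IsNonFreeCyclic M ∧ ¬ ∃ N, IsNonUnimodularFreeCyclic N ∧ M ≤ N}

end general

section three

variable {F : Type*} [Field F]

/-- The matrix with rows `(0, 0, 0)`, `(a, b, 0)`, `(c, d, e)`. -/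
def low (a b c d e : F) : LowerTri 3 F :=
  ⟨!![0, 0, 0; a, b, 0; c, d, e], by
    intro i j h
    fin_cases i <;> fin_cases j <;> simp at h ⊢⟩

/-- The subsets of the first form in the first set. -/
def firstSubsetA (r32 r33 : F) : Set (Submodule (LowerTri 3 F) (LowerTri 3 F × LowerTri 3 F)) :=
  {M | ∃ p21 p31 r21 r31 : F, M = cyc (low p21 1 p31 0 1, low r21 0 r31 r32 r33)}

/-- The subsets of the second form in the first set. -/
def firstSubsetB (r32 : F) : Set (Submodule (LowerTri 3 F) (LowerTri 3 F × LowerTri 3 F)) :=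
  {M | ∃ p21 p31 r21 r31 : F, M = cyc (low p21 1 p31 0 0, low r21 0 r31 r32 1)}

/-- The subsets of the first form in the `k`-set. -/
def kSubsetA (k p32 p33 : F) : Set (Submodule (LowerTri 3 F) (LowerTri 3 F × LowerTri 3 F)) :=
  {M | ∃ p21 p31 r21 r31 : F, M = cyc (low p21 k p31 p32 p33, low r21 1 r31 0 1)}

/-- The subsets of the second form in the `k`-set. -/
def kSubsetB (k p32 : F) : Set (Submodule (LowerTri 3 F) (LowerTri 3 F × LowerTri 3 F)) :=
  {M | ∃ p21 p31 r21 r31 : F, M = cyc (low p21 k p31 p32 1, low r21 1 r31 0 0)}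

end three

section families

variable (F : Type*) [Field F]

def firstA : Set (Set (Submodule (LowerTri 3 F) (LowerTri 3 F × LowerTri 3 F))) :=
  {C | ∃ r32 r33 : F, C = firstSubsetA r32 r33}

def firstB : Set (Set (Submodule (LowerTri 3 F) (LowerTri 3 F × LowerTri 3 F))) :=
  {C | ∃ r32 : F, C = firstSubsetB r32}

/-- The first set, a collection of subsets. -/
def firstSet : Set (Set (Submodule (LowerTri 3 F) (LowerTri 3 F × LowerTri 3 F))) :=
  firstA F ∪ firstB F

variable {F}

def kA (k : F) : Set (Set (Submodule (LowerTri 3 F) (LowerTri 3 F × LowerTri 3 F))) :=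
  {C | ∃ p32 p33 : F, C = kSubsetA k p32 p33}

def kB (k : F) : Set (Set (Submodule (LowerTri 3 F) (LowerTri 3 F × LowerTri 3 F))) :=
  {C | ∃ p32 : F, C = kSubsetB k p32}

/-- The `k`-set, a collection of subsets. -/
def kSet (k : F) : Set (Set (Submodule (LowerTri 3 F) (LowerTri 3 F × LowerTri 3 F))) :=
  kA k ∪ kB k

variable (F)

/-- The collection consisting of the first set and all the `k`-sets. -/
def allSets : Set (Set (Set (Submodule (LowerTri 3 F) (LowerTri 3 F × LowerTri 3 F)))) :=
  {S | S = firstSet F ∨ ∃ k : F, S = kSet k}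

end families

end TriPairs

open TriPairs

namespace TriPairs

section general

variable {n : ℕ} {F : Type*} [Field F]

/-! The exceptional submodules are those generated by a pair with both (1,1) entries zero, but with
a non-zero (2,2) entry and a non-zero (3,3) entry. Diagonal entries multiply, so a free generator of
a larger submodule inherits the last two conditions. It also has a non-zero (1,1) entry, since
otherwise the matrix unit at (1,1) annihilates it. Hence it is unimodular (`cyc_mem_exceptional`).
Every other non-free pair is a multiple of an explicit free pair that is not unimodular
(`exists_freePair_not_unimodular`), and such a pair is an outlier
(`FreePair.outlier_of_not_unimodular`).

With a zero first row, row reduction of the second and third rows gives a unique normal form `rep`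
(`exists_cyc_eq_cyc_rep`, `cyc_rep_injective`). Its parameters are two points of the projective
line, one scalar and four first-column entries, whence the number (q + 1)² · q · q⁴. -/

theorem mem_cyc {v u : LowerTri n F × LowerTri n F} :
    v ∈ cyc u ↔ ∃ A : LowerTri n F, A * u.1 = v.1 ∧ A * u.2 = v.2 := by
  simp only [cyc, Submodule.mem_span_singleton, Prod.ext_iff, Prod.smul_fst, Prod.smul_snd,
    smul_eq_mul]

theorem mem_cyc_self (v : LowerTri n F × LowerTri n F) : v ∈ cyc v :=
  Submodule.mem_span_singleton_self v

theorem cyc_le_cyc {v u : LowerTri n F × LowerTri n F} : cyc v ≤ cyc u ↔ v ∈ cyc u := by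
  simp [cyc, Submodule.span_le]

end general

variable {F : Type*} [Field F]

/-! ### Entrywise description of cyclic submodules and freeness -/

/-- The matrix with rows `(a, 0, 0)`, `(b, c, 0)`, `(d, e, f)`. -/
def tri (a b c d e f : F) : LowerTri 3 F :=
  ⟨!![a, 0, 0; b, c, 0; d, e, f], by
    intro i j h
    fin_cases i <;> fin_cases j <;> simp at h ⊢⟩

theorem low_eq_tri (a b c d e : F) : low a b c d e = tri 0 a b c d e := rfl

theorem exists_eq_tri (A : LowerTri 3 F) : ∃ a b c d e f, A = tri a b c d e f := by
  refine ⟨A.1 0 0, A.1 1 0, A.1 1 1, A.1 2 0, A.1 2 1, A.1 2 2, ?_⟩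
  apply Subtype.ext
  ext i j
  have h := A.2 i j
  fin_cases i <;> fin_cases j <;> first | rfl | exact h (by decide)

theorem tri_inj {a b c d e f a' b' c' d' e' f' : F} :
    tri a b c d e f = tri a' b' c' d' e' f' ↔
      a = a' ∧ b = b' ∧ c = c' ∧ d = d' ∧ e = e' ∧ f = f' := by
  constructor
  · intro h
    have h' : ∀ i j, (tri a b c d e f).1 i j = (tri a' b' c' d' e' f').1 i j := by simp [h]
    exact ⟨h' 0 0, h' 1 0, h' 1 1, h' 2 0, h' 2 1, h' 2 2⟩
  · rintro ⟨rfl, rfl, rfl, rfl, rfl, rfl⟩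
    rfl

theorem zero_eq_tri : (0 : LowerTri 3 F) = tri 0 0 0 0 0 0 := by
  apply Subtype.ext
  ext i j
  fin_cases i <;> fin_cases j <;> rfl

theorem tri_mul_tri (a b c d e f a' b' c' d' e' f' : F) :
    tri a b c d e f * tri a' b' c' d' e' f' =
      tri (a * a') (b * a' + c * b') (c * c') (d * a' + e * b' + f * d') (e * c' + f * e')
        (f * f') := by
  apply Subtype.ext
  ext i j
  fin_cases i <;> fin_cases j <;>
    simp [tri, Matrix.mul_apply, Fin.sum_univ_three]

theorem mem_cyc_tri {a b c d e f g h i j k l a' b' c' d' e' f' g' h' i' j' k' l' : F} :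
    (tri a b c d e f, tri g h i j k l) ∈ cyc (tri a' b' c' d' e' f', tri g' h' i' j' k' l') ↔
      ∃ p q r s t u : F,
        (p * a' = a ∧ q * a' + r * b' = b ∧ r * c' = c ∧ s * a' + t * b' + u * d' = d ∧
          t * c' + u * e' = e ∧ u * f' = f) ∧
        (p * g' = g ∧ q * g' + r * h' = h ∧ r * i' = i ∧ s * g' + t * h' + u * j' = j ∧
          t * i' + u * k' = k ∧ u * l' = l) := by
  rw [mem_cyc]
  constructor
  · rintro ⟨A, h⟩
    obtain ⟨p, q, r, s, t, u, rfl⟩ := exists_eq_tri A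
    simp only [tri_mul_tri, tri_inj] at h
    exact ⟨p, q, r, s, t, u, h⟩
  · rintro ⟨p, q, r, s, t, u, h⟩
    refine ⟨tri p q r s t u, ?_⟩
    simpa only [tri_mul_tri, tri_inj] using h

theorem freePair_tri {a b c d e f g h i j k l : F} :
    FreePair (tri a b c d e f, tri g h i j k l) ↔
      ∀ p q r s t u : F,
        (p * a = 0 ∧ q * a + r * b = 0 ∧ r * c = 0 ∧ s * a + t * b + u * d = 0 ∧
          t * c + u * e = 0 ∧ u * f = 0) →
        (p * g = 0 ∧ q * g + r * h = 0 ∧ r * i = 0 ∧ s * g + t * h + u * j = 0 ∧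
          t * i + u * k = 0 ∧ u * l = 0) →
        p = 0 ∧ q = 0 ∧ r = 0 ∧ s = 0 ∧ t = 0 ∧ u = 0 := by
  constructor
  · intro H p q r s t u h₁ h₂
    have := H (tri p q r s t u)
    simp only [tri_mul_tri, zero_eq_tri, tri_inj, Prod.mk.injEq] at this
    exact this ⟨h₁, h₂⟩
  · intro H A
    obtain ⟨p, q, r, s, t, u, rfl⟩ := exists_eq_tri A
    simp only [tri_mul_tri, zero_eq_tri, tri_inj, Prod.mk.injEq]
    exact fun h => H p q r s t u h.1 h.2

theorem unimodular_tri {a b c d e f g h i j k l : F} :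
    Unimodular (tri a b c d e f, tri g h i j k l) ↔
      (a ≠ 0 ∨ g ≠ 0) ∧ (c ≠ 0 ∨ i ≠ 0) ∧ (f ≠ 0 ∨ l ≠ 0) := by
  simp [Unimodular, Fin.forall_fin_succ, tri]

theorem exists_eq_tri_pair (v : LowerTri 3 F × LowerTri 3 F) :
    ∃ a b c d e f g h i j k l, v = (tri a b c d e f, tri g h i j k l) := by
  obtain ⟨X, Y⟩ := v
  obtain ⟨a, b, c, d, e, f, rfl⟩ := exists_eq_tri X
  obtain ⟨g, h, i, j, k, l, rfl⟩ := exists_eq_tri Y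
  exact ⟨_, _, _, _, _, _, _, _, _, _, _, _, rfl⟩

/-- A free generator lying in a cyclic submodule generated by a unimodular pair is unimodular. -/
theorem FreePair.unimodular_of_mem {v u : LowerTri 3 F × LowerTri 3 F} (hv : FreePair v)
    (hu : Unimodular u) (h : v ∈ cyc u) : Unimodular v := by
  obtain ⟨a, b, c, d, e, f, g, h, i, j, k, l, rfl⟩ := exists_eq_tri_pair v
  obtain ⟨a', b', c', d', e', f', g', h', i', j', k', l', rfl⟩ := exists_eq_tri_pair u
  rw [unimodular_tri] at hu ⊢
  rw [freePair_tri] at hv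
  obtain ⟨p, q, r, s, t, u, ⟨rfl, rfl, rfl, rfl, rfl, rfl⟩, rfl, rfl, rfl, rfl, rfl, rfl⟩ :=
    mem_cyc_tri.1 h
  -- If the multiplier had a zero diagonal entry, a non-zero matrix would annihilate it from the
  -- left, hence annihilate the free pair. The witnesses below have one non-zero row, built from
  -- cofactors of the multiplier.
  have hp : p ≠ 0 := by
    rintro rfl
    simpa using hv 1 0 0 0 0 0 (by simp) (by simp)
  have hr : r ≠ 0 := by
    rintro rfl
    refine hp (hv 0 (-q) p 0 0 0 ?_ ?_).2.2.1 <;> simp <;> ring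
  have hw : u ≠ 0 := by
    rintro rfl
    refine mul_ne_zero hp hr (hv 0 0 0 (q * t - s * r) (-(t * p)) (p * r) ?_ ?_).2.2.2.2.2 <;>
      simp <;> constructor <;> ring
  simpa [hp, hr, hw] using hu

theorem FreePair.outlier_of_not_unimodular {v : LowerTri 3 F × LowerTri 3 F} (hv : FreePair v)
    (h : ¬ Unimodular v) : Outlier v := by
  rintro M ⟨u, hu, rfl⟩ hm
  exact h (hv.unimodular_of_mem hu hm)

/-! ### Embedding non-free pairs into free non-unimodular ones -/

/-- Allows the (1,1) entries, possibly both zero, to be replaced by a non-zero vector e of which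
they are a multiple; f completes e to a basis of determinant 1. -/
theorem exists_adapted_basis (x y : F) :
    ∃ a e₁ e₂ f₁ f₂ : F, a * e₁ = x ∧ a * e₂ = y ∧ e₁ * f₂ - e₂ * f₁ = 1 := by
  by_cases hx : x = 0
  · subst hx
    by_cases hy : y = 0
    · subst hy
      exact ⟨0, 1, 0, 0, 1, by simp⟩
    · exact ⟨y, 0, 1, -1, 0, by simp⟩
  · refine ⟨x, 1, y / x, 0, 1, by simp, ?_, by simp⟩
    field_simp

theorem eq_zero_of_mul_eq_zero {x a b : F} (h : a ≠ 0 ∨ b ≠ 0) (ha : x * a = 0)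
    (hb : x * b = 0) : x = 0 :=
  h.elim (fun h => (mul_eq_zero.1 ha).resolve_right h) fun h => (mul_eq_zero.1 hb).resolve_right h

/-- The (3,3) entries force the last column of an annihilator to vanish, then the (2,2) entries its
middle column, then the (1,1) entries its first. -/
theorem freePair_tri_of_ne_zero {a b c d e f g h i j k l : F} (h11 : a ≠ 0 ∨ g ≠ 0)
    (h22 : c ≠ 0 ∨ i ≠ 0) (h33 : f ≠ 0 ∨ l ≠ 0) :
    FreePair (tri a b c d e f, tri g h i j k l) := by
  rw [freePair_tri]
  rintro p q r s t u ⟨h1, h2, h3, h4, h5, h6⟩ ⟨g1, g2, g3, g4, g5, g6⟩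
  obtain rfl := eq_zero_of_mul_eq_zero h33 h6 g6
  obtain rfl := eq_zero_of_mul_eq_zero h22 h3 g3
  obtain rfl := eq_zero_of_mul_eq_zero h22 (x := t) (by simpa using h5) (by simpa using g5)
  exact ⟨eq_zero_of_mul_eq_zero h11 h1 g1,
    eq_zero_of_mul_eq_zero h11 (by simpa using h2) (by simpa using g2), rfl,
    eq_zero_of_mul_eq_zero h11 (by simpa using h4) (by simpa using g4), rfl, rfl⟩

/-- A pair that is neither free nor of the form `v₁₁ = 0`, `v₂₂ ≠ 0`, `v₃₃ ≠ 0` lies in a free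
cyclic submodule whose generator is not unimodular. -/
theorem exists_freePair_not_unimodular {a b c d e f g h i j k l : F}
    (hw : ¬ FreePair (tri a b c d e f, tri g h i j k l))
    (hne : ¬ (a = 0 ∧ g = 0 ∧ (c ≠ 0 ∨ i ≠ 0) ∧ (f ≠ 0 ∨ l ≠ 0))) :
    ∃ v : LowerTri 3 F × LowerTri 3 F, FreePair v ∧ ¬ Unimodular v ∧
      (tri a b c d e f, tri g h i j k l) ∈ cyc v := by
  obtain ⟨m, e₁, e₂, f₁, f₂, rfl, rfl, hdet⟩ := exists_adapted_basis a g
  have hzero : ∀ x y : F, x * e₁ + y * f₁ = 0 → x * e₂ + y * f₂ = 0 → x = 0 ∧ y = 0 := by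
    intro x y h₁ h₂
    constructor
    · linear_combination f₂ * h₁ - f₁ * h₂ - x * hdet
    · linear_combination e₁ * h₂ - e₂ * h₁ - y * hdet
  have he : ∀ x : F, x * e₁ = 0 → x * e₂ = 0 → x = 0 := fun x h₁ h₂ =>
    (hzero x 0 (by simpa using h₁) (by simpa using h₂)).1
  -- With zero (2,2) entries, e and f serve as the first-column entries of rows one and two;
  -- Cramer's rule recovers (b, h) from them. Freeness needs only a third row that is non-zero
  -- outside the first column.
  by_cases h22 : c = 0 ∧ i = 0
  · obtain ⟨rfl, rfl⟩ := h22
    have hfree : ∀ d' e' f' j' k' l' : F, (e' ≠ 0 ∨ f' ≠ 0 ∨ k' ≠ 0 ∨ l' ≠ 0) →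
        FreePair (tri e₁ f₁ 0 d' e' f', tri e₂ f₂ 0 j' k' l') := by
      intro d' e' f' j' k' l' hn
      rw [freePair_tri]
      rintro p q r s t u ⟨h1, h2, -, h3, h4, h5⟩ ⟨g1, g2, -, g3, g4, g5⟩
      have hu : u = 0 := by
        simp only [mul_zero, zero_add, mul_eq_zero] at h4 h5 g4 g5
        tauto
      subst hu
      have h₁ := hzero q r h2 g2
      have h₂ := hzero s t (by simpa using h3) (by simpa using g3)
      exact ⟨he p h1 g1, h₁.1, h₁.2, h₂.1, h₂.2, rfl⟩
    by_cases hn : e ≠ 0 ∨ f ≠ 0 ∨ k ≠ 0 ∨ l ≠ 0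
    · refine ⟨_, hfree d e f j k l hn, by simp [unimodular_tri], mem_cyc_tri.2
        ⟨m, b * f₂ - h * f₁, h * e₁ - b * e₂, 0, 0, 1, ?_, ?_⟩⟩
      · exact ⟨rfl, by linear_combination b * hdet, by ring, by ring, by ring, by ring⟩
      · exact ⟨rfl, by linear_combination h * hdet, by ring, by ring, by ring, by ring⟩
    -- Here the third row lives in the first column, so it is a combination of e and f, and the
    -- third row of the new generator is arbitrary.
    · push Not at hn
      obtain ⟨rfl, rfl, rfl, rfl⟩ := hn
      refine ⟨_, hfree 0 0 1 0 0 0 (by simp), by simp [unimodular_tri], mem_cyc_tri.2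
        ⟨m, b * f₂ - h * f₁, h * e₁ - b * e₂, d * f₂ - j * f₁, j * e₁ - d * e₂, 0, ?_, ?_⟩⟩
      · exact ⟨rfl, by linear_combination b * hdet, by ring, by linear_combination d * hdet,
          by ring, by ring⟩
      · exact ⟨rfl, by linear_combination h * hdet, by ring, by linear_combination j * hdet,
          by ring, by ring⟩
  by_cases h33 : f = 0 ∧ l = 0
  · obtain ⟨rfl, rfl⟩ := h33
    have hr0 (r : F) := eq_zero_of_mul_eq_zero (x := r) (not_and_or.1 h22)
    -- If the third row depends on e and the second row, it can be discarded and f put in its place;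
    -- otherwise it is kept, and independence gives freeness.
    by_cases hdep : ∃ s t, s * e₁ + t * b = d ∧ t * c = e ∧ s * e₂ + t * h = j ∧ t * i = k
    · obtain ⟨s, t, rfl, rfl, rfl, rfl⟩ := hdep
      refine ⟨(tri e₁ b c f₁ 0 0, tri e₂ h i f₂ 0 0), ?_, by simp [unimodular_tri],
        mem_cyc_tri.2 ⟨m, 0, 1, s, t, 0, by simp, by simp⟩⟩
      rw [freePair_tri]
      rintro p q r s t u ⟨h1, h2, h3, h4, h5, -⟩ ⟨g1, g2, g3, g4, g5, -⟩
      obtain rfl := hr0 r h3 g3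
      obtain rfl := hr0 t (by simpa using h5) (by simpa using g5)
      have h₁ := hzero s u (by simpa using h4) (by simpa using g4)
      exact ⟨he p h1 g1, he q (by simpa using h2) (by simpa using g2), rfl, h₁.1, rfl, h₁.2⟩
    · refine ⟨(tri e₁ b c d e 0, tri e₂ h i j k 0), ?_, by simp [unimodular_tri],
        mem_cyc_tri.2 ⟨m, 0, 1, 0, 0, 1, by simp, by simp⟩⟩
      rw [freePair_tri]
      rintro p q r s t u ⟨h1, h2, h3, h4, h5, -⟩ ⟨g1, g2, g3, g4, g5, -⟩
      obtain rfl := hr0 r h3 g3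
      have hu : u = 0 := by
        by_contra hu
        refine hdep ⟨-s / u, -t / u, ?_, ?_, ?_, ?_⟩ <;> field_simp
        · linear_combination -h4
        · linear_combination -h5
        · linear_combination -g4
        · linear_combination -g5
      subst hu
      obtain rfl := hr0 t (by simpa using h5) (by simpa using g5)
      exact ⟨he p h1 g1, he q (by simpa using h2) (by simpa using g2), rfl,
        he s (by simpa using h4) (by simpa using g4), rfl, rfl⟩
  · refine absurd (freePair_tri_of_ne_zero ?_ ?_ ?_) hw
    · by_contra! hm
      exact hne ⟨hm.1, hm.2, by rwa [← not_and_or], by rwa [← not_and_or]⟩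
    · rwa [← not_and_or]
    · rwa [← not_and_or]

/-! ### Normal forms of the generators -/

/-- The normal forms of the generators of the exceptional submodules: `o` and `o'` encode the
points of the projective line over `F` spanned by the second and third diagonal entries, `t` is the
remaining invariant, and the last four parameters are the entries of the first columns. -/
def rep : (Option F × Option F × F) × (F × F × F × F) → LowerTri 3 F × LowerTri 3 F
  | ((none, some s, t), (a, b, c, d)) => (low a 1 b 0 1, low c 0 d t s)
  | ((none, none, t), (a, b, c, d)) => (low a 1 b 0 0, low c 0 d t 1)
  | ((some k, some s, t), (a, b, c, d)) => (low a k b t s, low c 1 d 0 1)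
  | ((some k, none, t), (a, b, c, d)) => (low a k b t 1, low c 1 d 0 0)

/-- One inclusion suffices. Comparing (2,2) and (3,3) entries makes the projective points agree and
the multipliers `r` and `u` equal to 1; the normalised zero at (3,2) then forces `t = 0`. -/
theorem cyc_rep_injective : Function.Injective fun x => cyc (rep (F := F) x) := by
  rintro ⟨⟨o, o', t⟩, a, b, c, d⟩ ⟨⟨m, m', t'⟩, a', b', c', d'⟩ h
  replace h : rep ((o, o', t), (a, b, c, d)) ∈ cyc (rep ((m, m', t'), (a', b', c', d'))) :=
    cyc_le_cyc.1 h.le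
  rcases o with _ | k <;> rcases o' with _ | s <;> rcases m with _ | k' <;>
    rcases m' with _ | s' <;> simp only [rep, low_eq_tri, mem_cyc_tri] at h <;>
    obtain ⟨p, q, r, s, t, u, ⟨-, h1, h2, h3, h4, h5⟩, -, g1, g2, g3, g4, g5⟩ := h <;>
    simp only [Prod.mk.injEq, reduceCtorEq, Option.some.injEq] <;> grind

/-- These are invertible row operations on rows two and three. The first column of the multiplier is
irrelevant because the first row is zero. -/
theorem cyc_tri_eq_cyc_tri {b c d e f h i j k l r u : F} (t : F) (hr : r ≠ 0) (hu : u ≠ 0) :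
    cyc (tri 0 b c d e f, tri 0 h i j k l) =
      cyc (tri 0 (r * b) (r * c) (t * b + u * d) (t * c + u * e) (u * f),
        tri 0 (r * h) (r * i) (t * h + u * j) (t * i + u * k) (u * l)) := by
  apply le_antisymm <;> rw [cyc_le_cyc, mem_cyc_tri]
  · refine ⟨0, 0, r⁻¹, 0, -(t * r⁻¹ * u⁻¹), u⁻¹, ?_, ?_⟩ <;>
      refine ⟨?_, ?_, ?_, ?_, ?_, ?_⟩ <;> field_simp <;> ring
  · exact ⟨0, 0, r, 0, t, u, by simp, by simp⟩

/-- A pair with `v₁₁ = 0`, `v₂₂ ≠ 0`, `v₃₃ ≠ 0` generates the submodule of some normal form. -/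
theorem exists_cyc_eq_cyc_rep {b c d e f h i j k l : F} (h22 : c ≠ 0 ∨ i ≠ 0)
    (h33 : f ≠ 0 ∨ l ≠ 0) :
    ∃ x, cyc (tri 0 b c d e f, tri 0 h i j k l) = cyc (rep x) := by
  suffices ∃ r t u x, r ≠ 0 ∧ u ≠ 0 ∧
      (tri 0 (r * b) (r * c) (t * b + u * d) (t * c + u * e) (u * f),
        tri 0 (r * h) (r * i) (t * h + u * j) (t * i + u * k) (u * l)) = rep x by
    obtain ⟨r, t, u, x, hr, hu, hx⟩ := this
    exact ⟨x, hx ▸ cyc_tri_eq_cyc_tri t hr hu⟩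
  -- The scalar r normalises (c, i) to (1, 0) or (k, 1), and t clears the (3,2) entry in the matrix
  -- holding that pivot 1. Then u normalises (f, l), preferring as pivot f when i = 0 and l
  -- otherwise.
  by_cases hi : i = 0
  · subst hi
    have hc : c ≠ 0 := by simpa using h22
    by_cases hf : f = 0
    · subst hf
      have hl : l ≠ 0 := by simpa using h33
      refine ⟨c⁻¹, -(l⁻¹ * e * c⁻¹), l⁻¹, ((none, none, l⁻¹ * k),
        (c⁻¹ * b, -(l⁻¹ * e * c⁻¹) * b + l⁻¹ * d, c⁻¹ * h, -(l⁻¹ * e * c⁻¹) * h + l⁻¹ * j)),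
        inv_ne_zero hc, inv_ne_zero hl, ?_⟩
      refine congrArg₂ Prod.mk (tri_inj.2 ⟨rfl, rfl, ?_, rfl, ?_, ?_⟩)
        (tri_inj.2 ⟨rfl, rfl, ?_, rfl, ?_, ?_⟩) <;> field_simp <;> ring
    · refine ⟨c⁻¹, -(f⁻¹ * e * c⁻¹), f⁻¹, ((none, some (f⁻¹ * l), f⁻¹ * k),
        (c⁻¹ * b, -(f⁻¹ * e * c⁻¹) * b + f⁻¹ * d, c⁻¹ * h, -(f⁻¹ * e * c⁻¹) * h + f⁻¹ * j)),
        inv_ne_zero hc, inv_ne_zero hf, ?_⟩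
      refine congrArg₂ Prod.mk (tri_inj.2 ⟨rfl, rfl, ?_, rfl, ?_, ?_⟩)
        (tri_inj.2 ⟨rfl, rfl, ?_, rfl, ?_, ?_⟩) <;> field_simp <;> ring
  · by_cases hl : l = 0
    · subst hl
      have hf : f ≠ 0 := by simpa using h33
      refine ⟨i⁻¹, -(f⁻¹ * k * i⁻¹), f⁻¹, ((some (i⁻¹ * c), none, f⁻¹ * (e - k * i⁻¹ * c)),
        (i⁻¹ * b, -(f⁻¹ * k * i⁻¹) * b + f⁻¹ * d, i⁻¹ * h, -(f⁻¹ * k * i⁻¹) * h + f⁻¹ * j)),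
        inv_ne_zero hi, inv_ne_zero hf, ?_⟩
      refine congrArg₂ Prod.mk (tri_inj.2 ⟨rfl, rfl, ?_, rfl, ?_, ?_⟩)
        (tri_inj.2 ⟨rfl, rfl, ?_, rfl, ?_, ?_⟩) <;> field_simp <;> ring
    · refine ⟨i⁻¹, -(l⁻¹ * k * i⁻¹), l⁻¹, ((some (i⁻¹ * c), some (l⁻¹ * f), l⁻¹ * (e - k * i⁻¹ * c)),
        (i⁻¹ * b, -(l⁻¹ * k * i⁻¹) * b + l⁻¹ * d, i⁻¹ * h, -(l⁻¹ * k * i⁻¹) * h + l⁻¹ * j)),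
        inv_ne_zero hi, inv_ne_zero hl, ?_⟩
      refine congrArg₂ Prod.mk (tri_inj.2 ⟨rfl, rfl, ?_, rfl, ?_, ?_⟩)
        (tri_inj.2 ⟨rfl, rfl, ?_, rfl, ?_, ?_⟩) <;> field_simp <;> ring

/-! ### Characterisation of the exceptional submodules -/

/-- Every generator lies in the submodule, so its (1,1) entries vanish too and the matrix unit at
(1,1) annihilates it. -/
theorem isNonFreeCyclic_cyc {b c d e f h i j k l : F} :
    IsNonFreeCyclic (cyc (tri 0 b c d e f, tri 0 h i j k l)) := by
  refine ⟨⟨_, rfl⟩, ?_⟩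
  rintro ⟨v, hv, hf⟩
  have hm := hv ▸ mem_cyc_self v
  obtain ⟨a', b', c', d', e', f', g', h', i', j', k', l', rfl⟩ := exists_eq_tri_pair v
  obtain ⟨p, q, r, s, t, u, ⟨h1, -⟩, g1, -⟩ := mem_cyc_tri.1 hm
  rw [mul_zero] at h1 g1
  subst h1 g1
  simpa using freePair_tri.1 hf 1 0 0 0 0 0 (by simp) (by simp)

theorem cyc_mem_exceptional {b c d e f h i j k l : F} (h22 : c ≠ 0 ∨ i ≠ 0)
    (h33 : f ≠ 0 ∨ l ≠ 0) :
    cyc (tri 0 b c d e f, tri 0 h i j k l) ∈ exceptional 3 F := by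
  refine ⟨isNonFreeCyclic_cyc, ?_⟩
  rintro ⟨N, ⟨⟨v, rfl, hf⟩, hN⟩, hle⟩
  refine hN ⟨v, ?_, rfl⟩
  rw [cyc_le_cyc] at hle
  obtain ⟨a', b', c', d', e', f', g', h', i', j', k', l', rfl⟩ := exists_eq_tri_pair v
  obtain ⟨p, q, r, s, t, u, ⟨-, -, rfl, -, -, rfl⟩, -, -, rfl, -, -, rfl⟩ := mem_cyc_tri.1 hle
  rw [unimodular_tri]
  refine ⟨?_, ?_, ?_⟩
  · by_contra! hn
    obtain ⟨rfl, rfl⟩ := hn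
    simpa using freePair_tri.1 hf 1 0 0 0 0 0 (by simp) (by simp)
  · exact h22.imp right_ne_zero_of_mul right_ne_zero_of_mul
  · exact h33.imp right_ne_zero_of_mul right_ne_zero_of_mul

theorem rep_mem_exceptional (x : (Option F × Option F × F) × (F × F × F × F)) :
    cyc (rep x) ∈ exceptional 3 F := by
  obtain ⟨⟨o, o', t⟩, a, b, c, d⟩ := x
  rcases o with _ | k <;> rcases o' with _ | s <;> simp only [rep, low_eq_tri] <;>
    exact cyc_mem_exceptional (by simp) (by simp)

/-- A non-free cyclic submodule is generated by a normal form or lies in a free cyclic submodule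
generated by an outlier. -/
theorem IsNonFreeCyclic.rep_or_outlier
    {M : Submodule (LowerTri 3 F) (LowerTri 3 F × LowerTri 3 F)} (hM : IsNonFreeCyclic M) :
    (∃ x, M = cyc (rep x)) ∨ ∃ v, Outlier v ∧ FreePair v ∧ M ≤ cyc v := by
  obtain ⟨⟨w, rfl⟩, hnf⟩ := hM
  have hw : ¬ FreePair w := fun h => hnf ⟨w, rfl, h⟩
  obtain ⟨a, b, c, d, e, f, g, h, i, j, k, l, rfl⟩ := exists_eq_tri_pair w
  by_cases hne : a = 0 ∧ g = 0 ∧ (c ≠ 0 ∨ i ≠ 0) ∧ (f ≠ 0 ∨ l ≠ 0)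
  · obtain ⟨rfl, rfl, h22, h33⟩ := hne
    exact Or.inl (exists_cyc_eq_cyc_rep h22 h33)
  · obtain ⟨v, hf, hu, hm⟩ := exists_freePair_not_unimodular hw hne
    exact Or.inr ⟨v, hf.outlier_of_not_unimodular hu, hf, cyc_le_cyc.2 hm⟩

theorem exceptional_eq_range : exceptional 3 F = Set.range fun x => cyc (rep (F := F) x) := by
  ext M
  constructor
  · rintro ⟨hM, hno⟩
    rcases hM.rep_or_outlier with ⟨x, rfl⟩ | ⟨v, ho, hf, hle⟩
    · exact ⟨x, rfl⟩
    · exact absurd ⟨cyc v, ⟨⟨v, rfl, hf⟩, fun hv => ho _ hv (mem_cyc_self v)⟩, hle⟩ hno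
  · rintro ⟨x, rfl⟩
    exact rep_mem_exceptional x

/-! ### The listed subsets as fibres of the normal form, and their numbers -/

/-- The subset of normal forms with the invariants `c`. -/
def repSubset (c : Option F × Option F × F) :
    Set (Submodule (LowerTri 3 F) (LowerTri 3 F × LowerTri 3 F)) :=
  Set.range fun x => cyc (rep (c, x))

/-- The first set for `o = none`, and the `k`-set for `o = some k`. -/
def repSet (o : Option F) : Set (Set (Submodule (LowerTri 3 F) (LowerTri 3 F × LowerTri 3 F))) :=
  Set.range fun x => repSubset (o, x)

theorem firstSubsetA_eq (t s : F) : firstSubsetA t s = repSubset (none, some s, t) := by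
  ext M
  simp [firstSubsetA, repSubset, rep, eq_comm]

theorem firstSubsetB_eq (t : F) : firstSubsetB t = repSubset (none, none, t) := by
  ext M
  simp [firstSubsetB, repSubset, rep, eq_comm]

theorem kSubsetA_eq (k t s : F) : kSubsetA k t s = repSubset (some k, some s, t) := by
  ext M
  simp [kSubsetA, repSubset, rep, eq_comm]

theorem kSubsetB_eq (k t : F) : kSubsetB k t = repSubset (some k, none, t) := by
  ext M
  simp [kSubsetB, repSubset, rep, eq_comm]

theorem firstA_eq : firstA F = Set.range fun x : F × F => repSubset (none, some x.2, x.1) := by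
  ext C
  simp [firstA, firstSubsetA_eq, eq_comm]

theorem firstB_eq : firstB F = Set.range fun t : F => repSubset (none, none, t) := by
  ext C
  simp [firstB, firstSubsetB_eq, eq_comm]

theorem kA_eq (k : F) :
    kA k = Set.range fun x : F × F => repSubset (some k, some x.2, x.1) := by
  ext C
  simp [kA, kSubsetA_eq, eq_comm]

theorem kB_eq (k : F) : kB k = Set.range fun t : F => repSubset (some k, none, t) := by
  ext C
  simp [kB, kSubsetB_eq, eq_comm]

theorem range_union_range_eq_repSet (o : Option F) :
    (Set.range fun x : F × F => repSubset (o, some x.2, x.1)) ∪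
      (Set.range fun t : F => repSubset (o, none, t)) = repSet o := by
  ext C
  simp only [repSet, Set.mem_union, Set.mem_range, Prod.exists, Option.exists]
  rw [or_comm, exists_comm (α := F) (β := F)]

theorem firstSet_eq : firstSet F = repSet none := by
  rw [firstSet, firstA_eq, firstB_eq, range_union_range_eq_repSet]

theorem kSet_eq (k : F) : kSet k = repSet (some k) := by
  rw [kSet, kA_eq, kB_eq, range_union_range_eq_repSet]

theorem allSets_eq : allSets F = Set.range (repSet (F := F)) := by
  ext S
  simp [allSets, firstSet_eq, kSet_eq, Option.exists, eq_comm]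

theorem sUnion_allSets_eq : ⋃₀ allSets F = Set.range (repSubset (F := F)) := by
  ext C
  simp [allSets_eq, repSet]

theorem sUnion_sUnion_allSets_eq :
    ⋃₀ (⋃₀ allSets F) = Set.range fun x => cyc (rep (F := F) x) := by
  ext M
  simp [sUnion_allSets_eq, repSubset]

theorem disjoint_repSubset {c c' : Option F × Option F × F} (h : c ≠ c') :
    Disjoint (repSubset c) (repSubset c') := by
  rw [Set.disjoint_left]
  rintro _ ⟨x, rfl⟩ ⟨y, hy⟩
  exact h (congrArg Prod.fst (cyc_rep_injective hy)).symm

/-- Distinct indices give disjoint sets, and these are non-empty. -/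
theorem repSubset_injective : Function.Injective (repSubset (F := F)) := by
  intro c c' h
  by_contra hne
  have := disjoint_repSubset hne
  rw [h, disjoint_self, Set.bot_eq_empty, repSubset, Set.range_eq_empty_iff] at this
  exact this.false (0, 0, 0, 0)

theorem disjoint_repSet {o o' : Option F} (h : o ≠ o') : Disjoint (repSet o) (repSet o') := by
  rw [Set.disjoint_left]
  rintro _ ⟨x, rfl⟩ ⟨y, hy⟩
  exact h (congrArg Prod.fst (repSubset_injective hy)).symm

theorem repSet_injective : Function.Injective (repSet (F := F)) := by
  intro o o' h
  by_contra hne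
  have := disjoint_repSet hne
  rw [h, disjoint_self, Set.bot_eq_empty, repSet, Set.range_eq_empty_iff] at this
  exact this.false (none, 0)

theorem ncard_range_of_injective {α β : Type*} [Fintype α] {f : α → β}
    (hf : Function.Injective f) : (Set.range f).ncard = Fintype.card α := by
  rw [← Set.image_univ, Set.ncard_image_of_injective _ hf, Set.ncard_univ,
    Nat.card_eq_fintype_card]

end TriPairs

open TriPairs
theorem mainTheorem7 (F : Type*) [Field F] [Fintype F] (q : ℕ) (hq : Fintype.card F = q) :
    -- the number of exceptional submodules
    (exceptional 3 F).ncard = (q + 1) ^ 2 * q ^ 5 ∧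
    -- they are exactly the members of the listed subsets
    exceptional 3 F = ⋃₀ (⋃₀ allSets F) ∧
    -- there are `q + 1` sets, without common subsets, each having `q ^ 2 + q` subsets
    (allSets F).ncard = q + 1 ∧
    (allSets F).PairwiseDisjoint id ∧
    (∀ S ∈ allSets F, S.ncard = q ^ 2 + q) ∧
    -- `q ^ 2` subsets of the first form and `q` of the second
    (firstA F).ncard = q ^ 2 ∧ (firstB F).ncard = q ∧
    (∀ k : F, (kA k).ncard = q ^ 2 ∧ (kB k).ncard = q) ∧
    -- the subsets are pairwise disjoint and have `q ^ 4` members each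
    (⋃₀ allSets F).PairwiseDisjoint id ∧
    (∀ C ∈ ⋃₀ allSets F, C.ncard = q ^ 4) ∧
    -- every other non-free cyclic submodule lies in a free one generated by an outlier
    (∀ M : Submodule (LowerTri 3 F) (LowerTri 3 F × LowerTri 3 F),
      IsNonFreeCyclic M → M ∉ ⋃₀ (⋃₀ allSets F) →
        ∃ v : LowerTri 3 F × LowerTri 3 F, Outlier v ∧ FreePair v ∧ M ≤ cyc v) := by
  have hA (o : Option F) :
      (Set.range fun x : F × F => repSubset (o, some x.2, x.1)).ncard = q ^ 2 := by
    rw [ncard_range_of_injective, Fintype.card_prod, hq, sq]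
    rintro ⟨x, y⟩ ⟨x', y'⟩ h
    have := repSubset_injective h
    simp_all
  have hB (o : Option F) : (Set.range fun t : F => repSubset (o, none, t)).ncard = q := by
    rw [ncard_range_of_injective, hq]
    intro t t' h
    simpa using repSubset_injective h
  rw [sUnion_sUnion_allSets_eq, sUnion_allSets_eq, allSets_eq, firstA_eq, firstB_eq,
    exceptional_eq_range]
  refine ⟨?_, rfl, ?_, ?_, ?_, hA none, hB none, fun k => ?_, ?_, ?_, ?_⟩
  · rw [ncard_range_of_injective cyc_rep_injective]
    simp only [Fintype.card_prod, Fintype.card_option, hq]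
    ring
  · rw [ncard_range_of_injective repSet_injective, Fintype.card_option, hq]
  · rintro _ ⟨o, rfl⟩ _ ⟨o', rfl⟩ h
    exact disjoint_repSet fun h' => h (congrArg _ h')
  · rintro _ ⟨o, rfl⟩
    rw [repSet, ncard_range_of_injective]
    · simp only [Fintype.card_prod, Fintype.card_option, hq]
      ring
    · exact repSubset_injective.comp (Prod.mk_right_injective o)
  · rw [kA_eq, kB_eq]
    exact ⟨hA _, hB _⟩
  · rintro _ ⟨c, rfl⟩ _ ⟨c', rfl⟩ h
    exact disjoint_repSubset fun h' => h (congrArg _ h')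
  · rintro _ ⟨c, rfl⟩
    rw [repSubset, ncard_range_of_injective]
    · simp only [Fintype.card_prod, hq]
      ring
    · exact cyc_rep_injective.comp (Prod.mk_right_injective c)
  · intro M hM hn
    exact hM.rep_or_outlier.resolve_left fun ⟨x, hx⟩ => hn ⟨x, hx.symm⟩
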